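/- There is a constant $C>0$ such that for every $n\ge 0$ the following holds (with $\log 0:=0$). For $a,b\in\mathbb R^n$ write $x=(a_1,\dots,a_n,b_1,\dots,b_n)\in\mathbb R^{2n}$, let $e_1,\dots,e_n,f_1,\dots,f_n$ be the standard basis of $\mathbb R^{2n}$, and let $$H_n=\{(e_i+f_j)-(e_k+f_l): i,j,k,l\in[n]\}.$$ There is a deterministic ternary decision tree $T_n$ (depending only on $n$), each of whose inner nodes queries the sign in $\{-,0,+\}$ of a linear form $\langle q,x\rangle$, such that: 1. each query $q$ is either an element of $H_n$ (a comparison "$a_i+b_j \ge a_k+b_l$?" of two elements of $A+B$) or a difference $h'-h''$ with $h',h''\in H_n$ (a differences-comparison "$a_i+b_j-a_{i'}-b_{j'}\ge a_k+b_l-a_{k'}-b_{l'}$?"); 2. each query $q$ has at most $8$ nonzero coefficients, and all its coefficients lie in $\{-1,0,1\}$; 3. the depth of $T_n$ (the maximal number of queries on a root-to-leaf path) is at most $C\,n\log^2 n$; 4. for every $x\in\mathbb R^{2n}$, the tree outputs $\bigl(\operatorname{sign}\langle h,x\rangle\bigr)_{h\in H_n}$, that is, the outcomes of all comparisons between $a_i+b_j$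 and $a_k+b_l$, $i,j,k,l\in[n]$; 5. consequently $T_n$ sorts sumsets: from the output of $T_n$ alone, with no further access to the input, one reads off a list of index pairs $(i,j)$ such that, whenever $A,B\subset\mathbb R$ have size $n$ and $A=\{a_1,\dots,a_n\}$, $B=\{b_1,\dots,b_n\}$, the corresponding list of sums $a_i+b_j$ is exactly the list of the elements of $A+B=\{a+b:a\in A,\ b\in B\}$ in strictly increasing order. -/

import Mathlib

open scoped Pointwise

/-- A ternary linear decision tree on inputs `x : ι → ℝ`. An inner node carries a linear query `q`;
its three subtrees are used when `⟨q, x⟩` is negative, zero and positive respectively.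
A leaf carries the output. -/
inductive LinearDecisionTree (ι Out : Type) : Type
  | leaf (out : Out) : LinearDecisionTree ι Out
  | node (q : ι → ℝ) (neg zero pos : LinearDecisionTree ι Out) : LinearDecisionTree ι Out

namespace LinearDecisionTree

variable {ι Out : Type}

/-- The maximal number of queries on a path from the root to a leaf. -/
def depth : LinearDecisionTree ι Out → ℕ
  | leaf _ => 0
  | node _ neg zero pos => max neg.depth (max zero.depth pos.depth) + 1

/-- The output of the tree on input `x`; the input is accessed only through the signs
of the queries along the path. -/
noncomputable def eval [Fintype ι] : LinearDecisionTree ι Out → (ι → ℝ) → Out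
  | leaf out, _ => out
  | node q neg zero pos, x =>
    match SignType.sign (q ⬝ᵥ x) with
    | SignType.neg => neg.eval x
    | SignType.zero => zero.eval x
    | SignType.pos => pos.eval x

/-- The set of all queries that occur at the inner nodes of the tree. -/
def queries : LinearDecisionTree ι Out → Set (ι → ℝ)
  | leaf _ => ∅
  | node q neg zero pos => {q} ∪ neg.queries ∪ zero.queries ∪ pos.queries

/-- The tree is a comparison decision tree with respect to `H`: every query is a label query
`h ∈ H` or a comparison query `h' - h''` with `h', h'' ∈ H`. -/
def IsComparisonTree (H : Set (ι → ℝ)) (T : LinearDecisionTree ι Out) : Prop :=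
  ∀ q ∈ T.queries, q ∈ H ∨ ∃ h' ∈ H, ∃ h'' ∈ H, q = h' - h''

end LinearDecisionTree

/-- The point-location function of `H`: the signs of `⟨h, x⟩` for all `h ∈ H`. -/
noncomputable def pointLocation {ι : Type} [Fintype ι] (H : Set (ι → ℝ)) (x : ι → ℝ) :
    H → SignType :=
  fun h => SignType.sign (h.1 ⬝ᵥ x)

/-- A vector is `s`-sparse if at most `s` of its coefficients are nonzero. -/
def IsSparse {ι : Type} (s : ℕ) (q : ι → ℝ) : Prop :=
  (Function.support q).encard ≤ s

/-- The coefficient vector of `(a i + b j) - (a k + b l)`, where the coordinates `Sum.inl` of the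
input stand for `a` and the coordinates `Sum.inr` stand for `b`. -/
def sumComparison {n : ℕ} (i j k l : Fin n) : Fin n ⊕ Fin n → ℝ :=
  (Pi.single (Sum.inl i) 1 + Pi.single (Sum.inr j) 1)
    - (Pi.single (Sum.inl k) 1 + Pi.single (Sum.inr l) 1)

/-- The vectors of all comparisons `a i + b j` versus `a k + b l` of two elements of `A + B`. -/
def sumsetVectors (n : ℕ) : Set (Fin n ⊕ Fin n → ℝ) :=
  {h | ∃ i j k l : Fin n, h = sumComparison i j k l}

/-! The proof rests on inference: the order of the values at `x` of a few forms `S`, together with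
their signs, may force the sign of another form `h` (`Infers`). Among `16d + 4` integer vectors of
ℓ¹-norm at most `4` in dimension `d`, one is always inferred from the others (`exists_infers`). To
see this, sort those of one sign by their values at `x`. A pigeonhole argument gives a `{-1, 0, 1}`
dependence among consecutive differences, and this writes one vector as the smallest one plus a
nonnegative combination of differences of the others.

By double counting, a random sample of `O(d + n)` forms then leaves more than half of the forms
undetermined only with probability `2⁻ⁿ` at each point (`card_bad_le`). To remove the randomness,
inputs are replaced by finitely many representatives of all sign patterns of possible queries; there
are only `2 ^ O(n log n)` of them (`exists_sign_representatives`). One fixed sample is good for all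
but a fraction `2⁻ⁿ` of the representatives (`exists_good_sample`).

A round sorts such a sample with `O(n log n)` queries. Either a constant fraction of the open forms
is settled, or all but a fraction `2⁻ⁿ` of the representatives is excluded. Each outcome can occur
only `O(log n)` times (`refinable_rounds`). Query coefficients stay in `{-1, 0, 1}` because each
sample is drawn from forms whose signs agree with a common colouring of the coordinates
(`exists_colouring`). -/

/-- `x` and `y` order the values of the linear forms in `S` in the same way. -/
def SameOrder {ι : Type} [Fintype ι] (S : Finset (ι → ℝ)) (x y : ι → ℝ) : Prop :=
  ∀ g ∈ S, ∀ h ∈ S, SignType.sign ((g - h) ⬝ᵥ x) = SignType.sign ((g - h) ⬝ᵥ y)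

theorem SameOrder.symm {ι : Type} [Fintype ι] {S : Finset (ι → ℝ)} {x y : ι → ℝ}
    (h : SameOrder S x y) : SameOrder S y x :=
  fun g hg k hk => (h g hg k hk).symm

theorem SameOrder.trans {ι : Type} [Fintype ι] {S : Finset (ι → ℝ)} {x y z : ι → ℝ}
    (h : SameOrder S x y) (h' : SameOrder S y z) : SameOrder S x z :=
  fun g hg k hk => (h g hg k hk).trans (h' g hg k hk)

theorem SameOrder.mono {ι : Type} [Fintype ι] {S T : Finset (ι → ℝ)} {x y : ι → ℝ}
    (h : SameOrder T x y) (hST : S ⊆ T) : SameOrder S x y :=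
  fun g hg k hk => h g (hST hg) k (hST hk)

theorem SameOrder.neg {ι : Type} [Fintype ι] {S : Finset (ι → ℝ)} {x y : ι → ℝ}
    (h : SameOrder S x y) : SameOrder S (-x) (-y) := by
  intro g hg k hk
  rw [dotProduct_neg, dotProduct_neg, Left.sign_neg, Left.sign_neg, h g hg k hk]

/-! ### Adaptive refinement of finite sets of inputs, and decision trees -/

open Classical in
/-- The region `X` can be refined with at most `D` adaptive queries from `Q` into regions that all
satisfy `P`. -/
inductive Refinable {ι : Type} [Fintype ι] (Q : Set (ι → ℝ)) (P : Finset (ι → ℝ) → Prop) :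
    ℕ → Finset (ι → ℝ) → Prop
  | done {D : ℕ} {X : Finset (ι → ℝ)} (h : P X) : Refinable Q P D X
  | query {D : ℕ} {X : Finset (ι → ℝ)} (q : ι → ℝ) (hq : q ∈ Q)
      (h : ∀ s : SignType, Refinable Q P D (X.filter fun x => SignType.sign (q ⬝ᵥ x) = s)) :
      Refinable Q P (D + 1) X

namespace Refinable

variable {ι : Type} [Fintype ι] {Q : Set (ι → ℝ)} {P P' : Finset (ι → ℝ) → Prop}

theorem mono_depth {D : ℕ} {X : Finset (ι → ℝ)} (h : Refinable Q P D X) :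
    ∀ {D' : ℕ}, D ≤ D' → Refinable Q P D' X := by
  induction h with
  | done h => exact fun _ => done h
  | query q hq _ ih =>
    intro D' hD
    obtain ⟨E, rfl⟩ : ∃ E, D' = E + 1 := ⟨D' - 1, by omega⟩
    exact query q hq fun s => ih s (by omega)

theorem bind {D D' : ℕ} {X : Finset (ι → ℝ)} (h : Refinable Q P D X) :
    (∀ Y ⊆ X, P Y → Refinable Q P' D' Y) → Refinable Q P' (D + D') X := by
  induction h with
  | done h => exact fun H => (H _ subset_rfl h).mono_depth (by omega)
  | @query D X q hq _ ih =>
    intro H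
    rw [Nat.add_right_comm]
    exact query q hq fun s => ih s fun Y hY => H Y (hY.trans (Finset.filter_subset _ _))

theorem exists_tree {Out : Type} [Nonempty Out] {F : (ι → ℝ) → Out}
    {D : ℕ} {X : Finset (ι → ℝ)}
    (h : Refinable Q (fun Y => ∃ o, ∀ x ∈ Y, F x = o) D X) :
    ∃ T : LinearDecisionTree ι Out, T.depth ≤ D ∧ T.queries ⊆ Q ∧ ∀ x ∈ X, T.eval x = F x := by
  induction h with
  | done h =>
    obtain ⟨o, ho⟩ := h
    exact ⟨.leaf o, by simp [LinearDecisionTree.depth], by simp [LinearDecisionTree.queries],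
      fun x hx => by simp [LinearDecisionTree.eval, ho x hx]⟩
  | @query D X q hq _ ih =>
    choose T hd hQ hT using ih
    refine ⟨.node q (T .neg) (T .zero) (T .pos), ?_, ?_, ?_⟩
    · simp only [LinearDecisionTree.depth]
      have := hd .neg
      have := hd .zero
      have := hd .pos
      omega
    · simp only [LinearDecisionTree.queries, Set.union_subset_iff, Set.singleton_subset_iff]
      exact ⟨⟨⟨hq, hQ _⟩, hQ _⟩, hQ _⟩
    · intro x hx
      have key : ∀ s, SignType.sign (q ⬝ᵥ x) = s → (T s).eval x = F x := fun s hs =>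
        hT s x (by simp [hx, hs])
      simp only [LinearDecisionTree.eval]
      split
      · exact key _ ‹_›
      · exact key _ ‹_›
      · exact key _ ‹_›

end Refinable

/-- A tree sees its input only through query signs. This carries correctness from the finite set of
representatives to all inputs. -/
theorem LinearDecisionTree.eval_eq_of_sign_eq {ι Out : Type} [Fintype ι] {x y : ι → ℝ} :
    ∀ T : LinearDecisionTree ι Out,
      (∀ q ∈ T.queries, SignType.sign (q ⬝ᵥ x) = SignType.sign (q ⬝ᵥ y)) → T.eval x = T.eval y
  | .leaf _, _ => rfl
  | .node q N Z P, h => by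
    simp only [LinearDecisionTree.queries, Set.mem_union, Set.mem_singleton_iff] at h
    have hN := eval_eq_of_sign_eq N fun q hq => h q (by tauto)
    have hZ := eval_eq_of_sign_eq Z fun q hq => h q (by tauto)
    have hP := eval_eq_of_sign_eq P fun q hq => h q (by tauto)
    simp only [LinearDecisionTree.eval, h q (by tauto), hN, hZ, hP]

/-! ### Medians and sorting by binary insertion -/

/-- A finite nonempty set has a median with respect to a real-valued function. -/
theorem Finset.exists_median {α : Type*} (U : Finset α) (hU : U.Nonempty) (f : α → ℝ) :
    ∃ g ∈ U, 2 * (U.filter fun u => f u < f g).card ≤ U.card ∧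
      2 * (U.filter fun u => f g < f u).card ≤ U.card := by
  classical
  obtain ⟨t, ht, htmax⟩ := U.exists_max_image f hU
  -- The median is the lowest `g` with at least half of `U` at or below it. If more than half lay
  -- strictly below, the highest of those would be a lower candidate.
  have hne : (U.filter fun g => U.card ≤ 2 * (U.filter fun u => f u ≤ f g).card).Nonempty := by
    refine ⟨t, Finset.mem_filter.2 ⟨ht, ?_⟩⟩
    rw [Finset.filter_true_of_mem htmax]
    omega
  obtain ⟨g, hg, hgmin⟩ := Finset.exists_min_image _ f hne
  rw [Finset.mem_filter] at hg
  refine ⟨g, hg.1, ?_, ?_⟩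
  · by_contra! hlt
    have hne' : (U.filter fun u => f u < f g).Nonempty := by
      rw [← Finset.card_pos]
      omega
    obtain ⟨g', hg', hmax⟩ := Finset.exists_max_image _ f hne'
    rw [Finset.mem_filter] at hg'
    have hsub : (U.filter fun u => f u < f g) ⊆ U.filter fun u => f u ≤ f g' := fun u hu =>
      Finset.mem_filter.2 ⟨(Finset.mem_filter.1 hu).1, hmax u hu⟩
    have := Finset.card_le_card hsub
    have := hgmin g' (Finset.mem_filter.2 ⟨hg'.1, by omega⟩)
    linarith [hg'.2]
  · have := Finset.card_filter_add_card_filter_not (s := U) (fun u => f u ≤ f g)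
    simp only [not_le] at this
    omega

section Sorting

variable {ι : Type} [Fintype ι]

open Classical in
theorem sameOrder_insert {S : Finset (ι → ℝ)} {h x y : ι → ℝ} (hS : SameOrder S x y)
    (hh : ∀ g ∈ S, SignType.sign ((h - g) ⬝ᵥ x) = SignType.sign ((h - g) ⬝ᵥ y)) :
    SameOrder (insert h S) x y := by
  intro g hg k hk
  rw [Finset.mem_insert] at hg hk
  rcases hg with rfl | hg <;> rcases hk with rfl | hk
  · simp
  · exact hh k hk
  · rw [← neg_sub k g, neg_dotProduct, neg_dotProduct, Left.sign_neg, Left.sign_neg, hh g hg]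
  · exact hS g hg k hk

open Classical in
/-- Binary search: a new form `h` is placed among the already sorted forms `S`. -/
theorem refinable_binary_search {Q : Set (ι → ℝ)} {S : Finset (ι → ℝ)} {h : ι → ℝ}
    (hQ : ∀ g ∈ S, h - g ∈ Q) (k : ℕ) :
    ∀ (U : Finset (ι → ℝ)) (X : Finset (ι → ℝ)), U ⊆ S → U.card < 2 ^ k →
      (∀ x ∈ X, ∀ y ∈ X, SameOrder S x y) →
      (∀ g ∈ S, g ∉ U → ∀ x ∈ X, ∀ y ∈ X,
        SignType.sign ((h - g) ⬝ᵥ x) = SignType.sign ((h - g) ⬝ᵥ y)) →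
      Refinable Q (fun Y => ∀ x ∈ Y, ∀ y ∈ Y, SameOrder (insert h S) x y) k X := by
  induction k with
  | zero =>
    intro U X _ hcard hX hU
    obtain rfl : U = ∅ := by simpa using hcard
    exact .done fun x hx y hy =>
      sameOrder_insert (hX x hx y hy) fun g hg => hU g hg (by simp) x hx y hy
  | succ k ih =>
    intro U X hUS hcard hX hU
    rcases X.eq_empty_or_nonempty with rfl | ⟨x₀, hx₀⟩
    · exact .done (by simp)
    rcases U.eq_empty_or_nonempty with rfl | hne
    · exact .done fun x hx y hy =>
        sameOrder_insert (hX x hx y hy) fun g hg => hU g hg (by simp) x hx y hy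
    -- `U` holds the forms whose comparison with `h` may still be open. All points of `X` order `S`
    -- alike, so the median at the single point `x₀` serves all of `X`.
    obtain ⟨g, hgU, hlt, hgt⟩ := U.exists_median hne fun u => u ⬝ᵥ x₀
    have hgS := hUS hgU
    have decomp : ∀ u y : ι → ℝ, (h - u) ⬝ᵥ y = (h - g) ⬝ᵥ y + (g - u) ⬝ᵥ y := by
      intro u y
      rw [← add_dotProduct, sub_add_sub_cancel]
    refine .query (h - g) (hQ g hgS) fun s => ?_
    have hXs : ∀ x ∈ X.filter (fun x => SignType.sign ((h - g) ⬝ᵥ x) = s),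
        ∀ y ∈ X.filter (fun x => SignType.sign ((h - g) ⬝ᵥ x) = s), SameOrder S x y :=
      fun x hx y hy => hX x (Finset.mem_filter.1 hx).1 y (Finset.mem_filter.1 hy).1
    cases s with
    | zero =>
      -- A tie of `h` with `g` settles everything: `h` compares with each `u` as `g` does.
      refine ih ∅ _ (by simp) (by simp) hXs fun u hu _ x hx y hy => ?_
      have hx' := (Finset.mem_filter.1 hx).2
      have hy' := (Finset.mem_filter.1 hy).2
      rw [decomp u x, decomp u y, sign_eq_zero_iff.1 hx', sign_eq_zero_iff.1 hy', zero_add,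
        zero_add]
      exact hXs x hx y hy g hgS u hu
    | neg =>
      refine ih (U.filter fun u => u ⬝ᵥ x₀ < g ⬝ᵥ x₀) _ ((Finset.filter_subset _ _).trans hUS)
        (by rw [pow_succ] at hcard; omega) hXs fun u hu hu' x hx y hy => ?_
      by_cases huU : u ∈ U
      · have hle : g ⬝ᵥ x₀ ≤ u ⬝ᵥ x₀ := by
          by_contra! hlt'
          exact hu' (Finset.mem_filter.2 ⟨huU, hlt'⟩)
        have key : ∀ y ∈ X.filter (fun x => SignType.sign ((h - g) ⬝ᵥ x) = SignType.neg),
            SignType.sign ((h - u) ⬝ᵥ y) = -1 := by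
          intro y hy
          rw [Finset.mem_filter] at hy
          have h1 : (h - g) ⬝ᵥ y < 0 := sign_eq_neg_one_iff.1 hy.2
          have h2 : (g - u) ⬝ᵥ y ≤ 0 := by
            rw [← sign_nonpos_iff, hX y hy.1 x₀ hx₀ g hgS u hu, sign_nonpos_iff, sub_dotProduct]
            linarith
          rw [sign_eq_neg_one_iff, decomp]
          linarith
        rw [key x hx, key y hy]
      · exact hU u hu huU x (Finset.mem_filter.1 hx).1 y (Finset.mem_filter.1 hy).1
    | pos =>
      refine ih (U.filter fun u => g ⬝ᵥ x₀ < u ⬝ᵥ x₀) _ ((Finset.filter_subset _ _).trans hUS)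
        (by rw [pow_succ] at hcard; omega) hXs fun u hu hu' x hx y hy => ?_
      by_cases huU : u ∈ U
      · have hle : u ⬝ᵥ x₀ ≤ g ⬝ᵥ x₀ := by
          by_contra! hlt'
          exact hu' (Finset.mem_filter.2 ⟨huU, hlt'⟩)
        have key : ∀ y ∈ X.filter (fun x => SignType.sign ((h - g) ⬝ᵥ x) = SignType.pos),
            SignType.sign ((h - u) ⬝ᵥ y) = 1 := by
          intro y hy
          rw [Finset.mem_filter] at hy
          have h1 : 0 < (h - g) ⬝ᵥ y := sign_eq_one_iff.1 hy.2
          have h2 : 0 ≤ (g - u) ⬝ᵥ y := by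
            rw [← sign_nonneg_iff, hX y hy.1 x₀ hx₀ g hgS u hu, sign_nonneg_iff, sub_dotProduct]
            linarith
          rw [sign_eq_one_iff, decomp]
          linarith
        rw [key x hx, key y hy]
      · exact hU u hu huU x (Finset.mem_filter.1 hx).1 y (Finset.mem_filter.1 hy).1

/-- Binary insertion sort. -/
theorem refinable_sort {Q : Set (ι → ℝ)} {k : ℕ} (S : Finset (ι → ℝ)) :
    (∀ g ∈ S, ∀ h ∈ S, g - h ∈ Q) → S.card ≤ 2 ^ k → ∀ X : Finset (ι → ℝ),
      Refinable Q (fun Y => ∀ x ∈ Y, ∀ y ∈ Y, SameOrder S x y) (S.card * k) X := by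
  classical
  induction S using Finset.induction_on with
  | empty => exact fun _ _ X => .done fun x _ y _ g hg => by simp at hg
  | insert h S hh ih =>
    intro hQ hcard X
    rw [Finset.card_insert_of_notMem hh] at hcard ⊢
    rw [Nat.add_mul, one_mul]
    refine (ih (fun g hg k hk => hQ g (by simp [hg]) k (by simp [hk])) (by omega) X).bind
      fun Y _ hY => ?_
    exact refinable_binary_search (fun g hg => hQ h (by simp) g (by simp [hg])) k S Y subset_rfl
      (by omega) hY fun g hg hg' => absurd hg hg'

end Sorting

/-! ### Counting sign patterns of a hyperplane arrangement -/

/-- Finitely many linear forms have at most `(3 * |Q| + 1) ^ dim W` sign patterns on a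
subspace `W`. -/
theorem exists_sign_representatives {ι : Type} [Fintype ι] (Q : Finset (ι → ℝ)) :
    ∀ W : Submodule ℝ (ι → ℝ), ∃ P : Finset (ι → ℝ),
      P.card ≤ (3 * Q.card + 1) ^ Module.finrank ℝ W ∧
      ∀ x ∈ W, ∃ p ∈ P, p ∈ W ∧ ∀ q ∈ Q, SignType.sign (q ⬝ᵥ x) = SignType.sign (q ⬝ᵥ p) := by
  classical
  induction Q using Finset.induction_on with
  | empty => exact fun W => ⟨{0}, by simp, fun x _ => ⟨0, by simp⟩⟩
  | insert q Q hq ih =>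
    intro W
    rw [Finset.card_insert_of_notMem hq]
    obtain ⟨P, hPc, hP⟩ := ih W
    by_cases hqW : ∀ x ∈ W, q ⬝ᵥ x = 0
    · refine ⟨P, hPc.trans (Nat.pow_le_pow_left (by omega) _), fun x hx => ?_⟩
      obtain ⟨p, hp, hpW, hpQ⟩ := hP x hx
      refine ⟨p, hp, hpW, fun r hr => ?_⟩
      rcases Finset.mem_insert.1 hr with rfl | hr
      · rw [hqW x hx, hqW p hpW]
      · exact hpQ r hr
    push Not at hqW
    obtain ⟨w, hw, hqw⟩ := hqW
    set K : Submodule ℝ (ι → ℝ) := LinearMap.ker (dotProductBilin ℝ ℝ q) with hK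
    have hmemK : ∀ x, x ∈ K ↔ q ⬝ᵥ x = 0 := fun x => by simp [hK]
    have hlt : Module.finrank ℝ ↥(W ⊓ K) < Module.finrank ℝ W := by
      refine Submodule.finrank_lt_finrank_of_lt (lt_of_le_of_ne inf_le_left fun he => hqw ?_)
      exact (hmemK w).1 (Submodule.mem_inf.1 (he.symm ▸ hw)).2
    obtain ⟨P₀, hP₀c, hP₀⟩ := ih (W ⊓ K)
    -- `f p` is a point of `W` with the `Q`-pattern of `p` and sign `s` on `q`, whenever one exists;
    -- otherwise it is the junk value `0`.
    have hf : ∀ s : SignType, ∃ f : (ι → ℝ) → (ι → ℝ), ∀ p x, x ∈ W →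
        (∀ r ∈ Q, SignType.sign (r ⬝ᵥ x) = SignType.sign (r ⬝ᵥ p)) →
        SignType.sign (q ⬝ᵥ x) = s → f p ∈ W ∧
        (∀ r ∈ Q, SignType.sign (r ⬝ᵥ f p) = SignType.sign (r ⬝ᵥ p)) ∧
        SignType.sign (q ⬝ᵥ f p) = s := by
      intro s
      have : ∀ p, ∃ z, ∀ x, x ∈ W →
        (∀ r ∈ Q, SignType.sign (r ⬝ᵥ x) = SignType.sign (r ⬝ᵥ p)) →
        SignType.sign (q ⬝ᵥ x) = s → z ∈ W ∧
        (∀ r ∈ Q, SignType.sign (r ⬝ᵥ z) = SignType.sign (r ⬝ᵥ p)) ∧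
        SignType.sign (q ⬝ᵥ z) = s := by
        intro p
        by_cases h : ∃ x ∈ W, (∀ r ∈ Q, SignType.sign (r ⬝ᵥ x) = SignType.sign (r ⬝ᵥ p)) ∧
          SignType.sign (q ⬝ᵥ x) = s
        · obtain ⟨z, hz⟩ := h
          exact ⟨z, fun _ _ _ _ => hz⟩
        · exact ⟨0, fun x h1 h2 h3 => absurd ⟨x, h1, h2, h3⟩ h⟩
      choose f hf using this
      exact ⟨f, hf⟩
    choose f hf using hf
    -- If a pattern is missed by `P`, then `q` has different signs at `x` and at its representative.
    -- The `Q`-pattern is then realised on `W ⊓ K`, and each pattern there extends by at most three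
    -- signs of `q`.
    refine ⟨P ∪ (P₀.image (f 0) ∪ (P₀.image (f 1) ∪ P₀.image (f (-1)))), ?_, fun x hx => ?_⟩
    · obtain ⟨D, hD⟩ : ∃ D, Module.finrank ℝ W = D + 1 := ⟨Module.finrank ℝ W - 1, by omega⟩
      have h0 : P₀.card ≤ (3 * Q.card + 1) ^ D :=
        hP₀c.trans (Nat.pow_le_pow_right (by omega) (by omega))
      rw [hD] at hPc ⊢
      have h1 := Finset.card_union_le P (P₀.image (f 0) ∪ (P₀.image (f 1) ∪ P₀.image (f (-1))))
      have h2 := Finset.card_union_le (P₀.image (f 0)) (P₀.image (f 1) ∪ P₀.image (f (-1)))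
      have h3 := Finset.card_union_le (P₀.image (f 1)) (P₀.image (f (-1)))
      have h4 := fun s => Finset.card_image_le (s := P₀) (f := f s)
      have h5 := h4 0
      have h6 := h4 1
      have h7 := h4 (-1)
      calc _ ≤ (3 * Q.card + 1) ^ (D + 1) + 3 * (3 * Q.card + 1) ^ D := by omega
        _ = (3 * Q.card + 1) ^ D * (3 * (Q.card + 1) + 1) := by ring
        _ ≤ (3 * (Q.card + 1) + 1) ^ D * (3 * (Q.card + 1) + 1) := by gcongr; omega
        _ = _ := by rw [pow_succ]
    · obtain ⟨p, hp, hpW, hpQ⟩ := hP x hx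
      by_cases hs : SignType.sign (q ⬝ᵥ x) = SignType.sign (q ⬝ᵥ p)
      · refine ⟨p, by simp [hp], hpW, fun r hr => ?_⟩
        rcases Finset.mem_insert.1 hr with rfl | hr
        · exact hs
        · exact hpQ r hr
      -- a point of the segment from `x` to `p` lies on the hyperplane of `q`
      obtain ⟨t, ht0, ht1, ht⟩ : ∃ t : ℝ, 0 ≤ t ∧ t ≤ 1 ∧
          (1 - t) * (q ⬝ᵥ x) + t * (q ⬝ᵥ p) = 0 := by
        have hne : q ⬝ᵥ x - q ⬝ᵥ p ≠ 0 := fun h => hs (by rw [sub_eq_zero.1 h])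
        rcases lt_trichotomy (q ⬝ᵥ x) 0 with h | h | h
        · have hp0 : 0 ≤ q ⬝ᵥ p := by
            by_contra! h'
            exact hs (by rw [sign_neg h, sign_neg h'])
          refine ⟨-(q ⬝ᵥ x) / (q ⬝ᵥ p - q ⬝ᵥ x), div_nonneg (by linarith) (by linarith),
            (div_le_one (by linarith)).2 (by linarith), ?_⟩
          have : q ⬝ᵥ p - q ⬝ᵥ x ≠ 0 := by linarith
          field_simp
          ring
        · exact ⟨0, le_rfl, zero_le_one, by simp [h]⟩
        · have hp0 : q ⬝ᵥ p ≤ 0 := by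
            by_contra! h'
            exact hs (by rw [sign_pos h, sign_pos h'])
          refine ⟨(q ⬝ᵥ x) / (q ⬝ᵥ x - q ⬝ᵥ p), div_nonneg (by linarith) (by linarith),
            (div_le_one (by linarith)).2 (by linarith), ?_⟩
          field_simp
          ring
      have hz : ∀ r : ι → ℝ, r ⬝ᵥ ((1 - t) • x + t • p) = (1 - t) * (r ⬝ᵥ x) + t * (r ⬝ᵥ p) := by
        intro r
        simp [dotProduct_add, dotProduct_smul]
      have hzQ : ∀ r ∈ Q, SignType.sign (r ⬝ᵥ x) = SignType.sign (r ⬝ᵥ ((1 - t) • x + t • p)) := by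
        intro r hr
        rw [hz]
        have hrp := hpQ r hr
        rcases lt_trichotomy (r ⬝ᵥ x) 0 with h | h | h
        · rw [sign_neg h] at hrp ⊢
          have := sign_eq_neg_one_iff.1 hrp.symm
          rw [eq_comm, sign_eq_neg_one_iff]
          rcases eq_or_lt_of_le ht0 with rfl | ht0
          · linarith
          · nlinarith
        · rw [h, sign_zero] at hrp
          rw [h, sign_eq_zero_iff.1 hrp.symm]
          simp
        · rw [sign_pos h] at hrp ⊢
          have := sign_eq_one_iff.1 hrp.symm
          rw [eq_comm, sign_eq_one_iff]
          rcases eq_or_lt_of_le ht0 with rfl | ht0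
          · linarith
          · nlinarith
      obtain ⟨p₀, hp₀, hp₀W, hp₀Q⟩ := hP₀ ((1 - t) • x + t • p) (Submodule.mem_inf.2
        ⟨W.add_mem (W.smul_mem _ hx) (W.smul_mem _ hpW), (hmemK _).2 (by rw [hz, ht])⟩)
      obtain ⟨h1, h2, h3⟩ := hf (SignType.sign (q ⬝ᵥ x)) p₀ x hx
        (fun r hr => (hzQ r hr).trans (hp₀Q r hr)) rfl
      refine ⟨f (SignType.sign (q ⬝ᵥ x)) p₀, ?_, h1, fun r hr => ?_⟩
      · have := Finset.mem_image_of_mem (f (SignType.sign (q ⬝ᵥ x))) hp₀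
        simp only [Finset.mem_union]
        rcases hsgn : SignType.sign (q ⬝ᵥ x) with _ | _ | _ <;> rw [hsgn] at this
        · exact Or.inr (Or.inl this)
        · exact Or.inr (Or.inr (Or.inr this))
        · exact Or.inr (Or.inr (Or.inl this))
      · rcases Finset.mem_insert.1 hr with rfl | hr
        · exact h3.symm
        · rw [h2 r hr, ← hp₀Q r hr, ← hzQ r hr]

/-! ### Inference dimension of short integer vectors -/

/-- The order of the values at `x` of the linear forms `S ∪ {0}` determines the sign of `h`. -/
def Infers {ι : Type} [Fintype ι] (S : Finset (ι → ℝ)) (x h : ι → ℝ) : Prop :=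
  ∀ y, SameOrder S x y → (∀ g ∈ S, SignType.sign (g ⬝ᵥ x) = SignType.sign (g ⬝ᵥ y)) →
    SignType.sign (h ⬝ᵥ x) = SignType.sign (h ⬝ᵥ y)

/-- Among more than `8 * |ι|` integer vectors of small norm there is a linear dependence with
coefficients in `{-1, 0, 1}`. -/
theorem exists_signed_dependence {ι : Type} [Fintype ι] {p : ℕ} (g : Fin p → ι → ℤ)
    (hg : ∀ i, ∑ c, (g i c).natAbs ≤ 8) (hp : 8 * Fintype.card ι < p) :
    ∃ α : Fin p → ℤ, α ≠ 0 ∧ (∀ i, |α i| ≤ 1) ∧ ∑ i, α i • g i = 0 := by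
  classical
  -- Pigeonhole on subset sums: coordinate `c` of a subset sum lies in `[-N c, M c]`, an interval of
  -- `s c + 1` integers. As `s c` totals at most `8p`, the box has at most `2 ^ (4|ι| + p/2) < 2 ^
  -- p` points.
  set N : ι → ℤ := fun c => ∑ i, max (-(g i c)) 0
  set M : ι → ℤ := fun c => ∑ i, max (g i c) 0
  set s : ι → ℕ := fun c => ∑ i, (g i c).natAbs
  have hs : ∀ c, M c + N c = s c := by
    intro c
    simp only [M, N, s, ← Finset.sum_add_distrib, Nat.cast_sum]
    refine Finset.sum_congr rfl fun i _ => ?_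
    omega
  have hpow : ∀ a : ℕ, a + 1 ≤ 2 ^ (4 + a / 16) := by
    intro a
    have : a / 16 < 2 ^ (a / 16) := Nat.lt_two_pow_self
    rw [pow_add]
    omega
  have hsum : ∑ c, s c / 16 ≤ p / 2 := by
    have h1 : ∑ c, s c ≤ 8 * p := by
      simp only [s]
      rw [Finset.sum_comm]
      calc _ ≤ ∑ _i : Fin p, 8 := Finset.sum_le_sum fun i _ => hg i
        _ = 8 * p := by simp [mul_comm]
    have h2 : (∑ c, s c / 16) * 16 ≤ ∑ c, s c := by
      rw [Finset.sum_mul]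
      exact Finset.sum_le_sum fun c _ => Nat.div_mul_le_self _ _
    omega
  have hcard : (Fintype.piFinset fun c => Finset.Icc (-N c) (M c)).card <
      (Finset.univ : Finset (Finset (Fin p))).card := by
    rw [Fintype.card_piFinset, Finset.card_univ, Fintype.card_finset, Fintype.card_fin]
    calc ∏ c, (Finset.Icc (-N c) (M c)).card ≤ ∏ c, 2 ^ (4 + s c / 16) := by
          refine Finset.prod_le_prod' fun c _ => ?_
          rw [Int.card_Icc]
          have := hs c
          have := hpow (s c)
          omega
      _ = 2 ^ (∑ c, (4 + s c / 16)) := Finset.prod_pow_eq_pow_sum _ _ _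
      _ < 2 ^ p := by
          refine Nat.pow_lt_pow_right one_lt_two ?_
          rw [Finset.sum_add_distrib, Finset.sum_const, Finset.card_univ, smul_eq_mul]
          omega
  obtain ⟨A, -, B, -, hAB, h⟩ := Finset.exists_ne_map_eq_of_card_lt_of_maps_to hcard
    (f := fun A : Finset (Fin p) => ∑ i ∈ A, g i) (by
      intro A _
      simp only [Finset.mem_coe, Fintype.mem_piFinset, Finset.sum_apply, Finset.mem_Icc, N, M]
      refine fun c => ⟨?_, ?_⟩
      · rw [neg_le, ← Finset.sum_neg_distrib]
        calc _ ≤ ∑ i ∈ A, max (-(g i c)) 0 := Finset.sum_le_sum fun i _ => by omega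
          _ ≤ _ := Finset.sum_le_sum_of_subset_of_nonneg (Finset.subset_univ _)
              fun i _ _ => by omega
      · calc _ ≤ ∑ i ∈ A, max (g i c) 0 := Finset.sum_le_sum fun i _ => by omega
          _ ≤ _ := Finset.sum_le_sum_of_subset_of_nonneg (Finset.subset_univ _)
              fun i _ _ => by omega)
  -- Two subsets have equal sums; the difference of their indicators is the dependence.
  refine ⟨fun i => (if i ∈ A then 1 else 0) - if i ∈ B then 1 else 0, fun h0 => hAB ?_, ?_, ?_⟩
  · ext i
    have := congrFun h0 i
    by_cases hA : i ∈ A <;> by_cases hB : i ∈ B <;> simp_all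
  · intro i
    dsimp only
    split_ifs <;> simp
  · simp only [sub_smul, ite_smul, one_smul, zero_smul, Finset.sum_sub_distrib,
      Finset.sum_ite_mem, Finset.univ_inter]
    exact sub_eq_zero.2 h

/-- A sum of nonnegative terms vanishes only if every term does, and is positive otherwise. -/
theorem sign_sum_eq_of_nonneg {α : Type*} (s : Finset α) {u v : α → ℝ} (hu : ∀ i ∈ s, 0 ≤ u i)
    (hv : ∀ i ∈ s, 0 ≤ v i) (h : ∀ i ∈ s, u i = 0 ↔ v i = 0) :
    SignType.sign (∑ i ∈ s, u i) = SignType.sign (∑ i ∈ s, v i) := by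
  have h0 : ∑ i ∈ s, u i = 0 ↔ ∑ i ∈ s, v i = 0 := by
    rw [Finset.sum_eq_zero_iff_of_nonneg hu, Finset.sum_eq_zero_iff_of_nonneg hv]
    exact forall₂_congr h
  rcases (Finset.sum_nonneg hu).eq_or_lt with hU | hU
  · rw [← hU, h0.1 hU.symm]
  · rw [sign_pos hU, sign_pos]
    exact lt_of_le_of_ne (Finset.sum_nonneg hv) fun hV => hU.ne' (h0.2 hV.symm)

section Infers

variable {ι : Type} [Fintype ι]

theorem Infers.mono {S T : Finset (ι → ℝ)} {x h : ι → ℝ} (H : Infers S x h) (hST : S ⊆ T) :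
    Infers T x h :=
  fun y hy hy' => H y (hy.mono hST) fun g hg => hy' g (hST hg)

theorem Infers.of_mem {S : Finset (ι → ℝ)} {x h : ι → ℝ} (hS : h ∈ S) : Infers S x h :=
  fun _ _ hy => hy h hS

theorem Infers.of_neg {S : Finset (ι → ℝ)} {x h : ι → ℝ} (H : Infers S (-x) h) :
    Infers S x h := by
  intro y hy hy'
  have := H (-y) hy.neg fun g hg => by
    rw [dotProduct_neg, dotProduct_neg, Left.sign_neg, Left.sign_neg, hy' g hg]
  rw [dotProduct_neg, dotProduct_neg, Left.sign_neg, Left.sign_neg] at this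
  exact neg_injective this

open Classical in
/-- Inference for sorted integer vectors with nonnegative values at `x`. -/
theorem exists_infers_of_nonneg {T : Finset (ι → ℝ)} {x : ι → ℝ} {p : ℕ}
    (hT : ∀ h ∈ T, ∃ z : ι → ℤ, (h = fun c => (z c : ℝ)) ∧ ∑ c, (z c).natAbs ≤ 4)
    (hcard : p + 1 ≤ T.card) (hp : 8 * Fintype.card ι < p) (hx : ∀ h ∈ T, 0 ≤ h ⬝ᵥ x) :
    ∃ h ∈ T, Infers (T.erase h) x h := by
  obtain ⟨T₀, hT₀, hT₀c⟩ := Finset.exists_subset_card_eq hcard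
  set e := T₀.equivFinOfCardEq hT₀c
  set σ := Tuple.sort fun i => (e.symm i).1 ⬝ᵥ x
  set v : Fin (p + 1) → ι → ℝ := fun i => (e.symm (σ i)).1 with hv
  have hvT : ∀ i, v i ∈ T := fun i => hT₀ (e.symm (σ i)).2
  have hvinj : Function.Injective v := fun i j hij => by
    simpa using Subtype.ext hij
  have hmono : Monotone fun i => v i ⬝ᵥ x := Tuple.monotone_sort fun i => (e.symm i).1 ⬝ᵥ x
  -- Differences of consecutive `v i` have norm at most `4 + 4 = 8`, as `exists_signed_dependence`
  -- requires.
  choose z hz hz4 using fun i => hT (v i) (hvT i)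
  obtain ⟨α, hα0, hα1, hα⟩ := exists_signed_dependence (p := p)
    (fun i => z i.succ - z i.castSucc) (fun i => by
      calc _ ≤ ∑ c, ((z i.succ c).natAbs + (z i.castSucc c).natAbs) :=
            Finset.sum_le_sum fun c _ => Int.natAbs_sub_le _ _
        _ ≤ 8 := by
          rw [Finset.sum_add_distrib]
          linarith [hz4 i.succ, hz4 i.castSucc]) hp
  have hne : (Finset.univ.filter fun i => α i ≠ 0).Nonempty := by
    obtain ⟨i, hi⟩ := Function.ne_iff.1 hα0
    exact ⟨i, by simpa using hi⟩
  obtain ⟨q, hq, hqmax⟩ := Finset.exists_max_image _ id hne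
  have hq0 : α q ≠ 0 := (Finset.mem_filter.1 hq).2
  have hgt : ∀ i, q < i → α i = 0 := by
    intro i hi
    by_contra h
    exact absurd (hqmax i (by simpa using h)) (not_le.2 hi)
  -- normalize so that the last nonzero coefficient is `1`
  obtain ⟨β, hβq, hβ1, hβgt, hβ⟩ : ∃ β : Fin p → ℤ, β q = 1 ∧ (∀ i, β i ≤ 1) ∧
      (∀ i, q < i → β i = 0) ∧ ∑ i, β i • (z i.succ - z i.castSucc) = 0 := by
    have := hα1 q
    rw [abs_le] at this
    rcases (by omega : α q = 1 ∨ α q = -1) with h | h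
    · exact ⟨α, h, fun i => (abs_le.1 (hα1 i)).2, hgt, hα⟩
    · exact ⟨-α, by simp [h], fun i => by
        have := (abs_le.1 (hα1 i)).1
        simp only [Pi.neg_apply]
        omega, fun i hi => by simp [hgt i hi], by
        simp only [Pi.neg_apply, neg_smul, Finset.sum_neg_distrib, hα, neg_zero]⟩
  have hβv : ∑ i, (β i : ℝ) • (v i.succ - v i.castSucc) = 0 := by
    ext c
    have := congrArg (fun n : ℤ => (n : ℝ)) (congrFun hβ c)
    simpa [hz] using this
  have htel : ∀ j : Fin (p + 1), ∑ i : Fin p, (if i.castSucc < j then v i.succ - v i.castSucc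
      else 0) = v j - v 0 := by
    intro j
    induction j using Fin.induction with
    | zero => simp
    | succ j ih =>
      have : ∀ i : Fin p, (if i.castSucc < j.succ then v i.succ - v i.castSucc else 0) =
          (if i.castSucc < j.castSucc then v i.succ - v i.castSucc else 0) +
          if i = j then v i.succ - v i.castSucc else 0 := by
        intro i
        rcases lt_trichotomy i j with h | h | h
        · simp [h, h.ne, Fin.castSucc_lt_succ_iff, h.le]
        · simp [h]
        · simp [h.not_ge, h.ne', h.not_gt, Fin.castSucc_lt_succ_iff]
      rw [Finset.sum_congr rfl fun i _ => this i, Finset.sum_add_distrib, ih]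
      simp
  -- Subtracting the dependence from the telescoping sum for `v q.succ - v 0` cancels the last
  -- difference since `β q = 1`, and leaves weights `1 - β i ≥ 0`. Only `v 0, …, v q` remain on the
  -- right, so `v q.succ` is inferred from other vectors.
  have hcomb : v q.succ = v 0 + ∑ i ∈ Finset.univ.filter (fun i => i < q),
      (1 - (β i : ℝ)) • (v i.succ - v i.castSucc) := by
    have h1 : ∀ i : Fin p, (if i < q then (1 - (β i : ℝ)) • (v i.succ - v i.castSucc) else 0) =
        (if i.castSucc < q.succ then v i.succ - v i.castSucc else 0) -
          (β i : ℝ) • (v i.succ - v i.castSucc) := by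
      intro i
      rcases lt_trichotomy i q with h | h | h
      · simp [h, Fin.castSucc_lt_succ_iff, h.le, sub_smul]
      · subst h
        simp [hβq]
      · simp [h.not_ge, h.not_gt, Fin.castSucc_lt_succ_iff, hβgt i h]
    rw [Finset.sum_filter, Finset.sum_congr rfl fun i _ => h1 i, Finset.sum_sub_distrib, hβv,
      htel]
    abel
  refine ⟨v q.succ, hvT _, fun y hy hy' => ?_⟩
  have hmem : ∀ j, j ≠ q.succ → v j ∈ T.erase (v q.succ) := fun j hj =>
    Finset.mem_erase.2 ⟨hvinj.ne hj, hvT j⟩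
  have h0 := hy' (v 0) (hmem 0 (Fin.succ_ne_zero q).symm)
  have hd : ∀ i < q, SignType.sign ((v i.succ - v i.castSucc) ⬝ᵥ x) =
      SignType.sign ((v i.succ - v i.castSucc) ⬝ᵥ y) := fun i hi =>
    hy _ (hmem _ (by simpa using hi.ne)) _ (hmem _ (Fin.castSucc_lt_succ_iff.2 hi.le).ne)
  have h0x : 0 ≤ v 0 ⬝ᵥ x := hx _ (hvT 0)
  have h0y : 0 ≤ v 0 ⬝ᵥ y := by rwa [← sign_nonneg_iff, ← h0, sign_nonneg_iff]
  have hdx : ∀ i : Fin p, 0 ≤ (v i.succ - v i.castSucc) ⬝ᵥ x := fun i => by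
    rw [sub_dotProduct, sub_nonneg]
    exact hmono (Fin.castSucc_lt_succ).le
  have hdy : ∀ i < q, 0 ≤ (v i.succ - v i.castSucc) ⬝ᵥ y := fun i hi => by
    rw [← sign_nonneg_iff, ← hd i hi, sign_nonneg_iff]
    exact hdx i
  have hexp : ∀ w : ι → ℝ, v q.succ ⬝ᵥ w = ∑ o ∈ Finset.insertNone (Finset.univ.filter fun i => i < q),
      Option.elim o (v 0 ⬝ᵥ w) fun i => (1 - (β i : ℝ)) * ((v i.succ - v i.castSucc) ⬝ᵥ w) := by
    intro w
    rw [Finset.sum_insertNone, hcomb, add_dotProduct, sum_dotProduct]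
    simp [smul_dotProduct]
  have hβ1' : ∀ i, 0 ≤ 1 - (β i : ℝ) := fun i => by
    rw [sub_nonneg]
    exact_mod_cast hβ1 i
  rw [hexp x, hexp y]
  refine sign_sum_eq_of_nonneg _ ?_ ?_ ?_
  · rintro (_ | i) hi
    · exact h0x
    · exact mul_nonneg (hβ1' i) (hdx i)
  · rintro (_ | i) hi
    · exact h0y
    · exact mul_nonneg (hβ1' i) (hdy i (by simpa using hi))
  · rintro (_ | i) hi
    · simp only [Option.elim]
      rw [← sign_eq_zero_iff, h0, sign_eq_zero_iff]
    · simp only [Option.elim, mul_eq_zero]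
      rw [← sign_eq_zero_iff (a := _ ⬝ᵥ x), hd i (by simpa using hi), sign_eq_zero_iff]

open Classical in
/-- The inference dimension of integer vectors of norm at most `4`. -/
theorem exists_infers {T : Finset (ι → ℝ)} (x : ι → ℝ)
    (hT : ∀ h ∈ T, ∃ z : ι → ℤ, (h = fun c => (z c : ℝ)) ∧ ∑ c, (z c).natAbs ≤ 4)
    (hcard : 16 * Fintype.card ι + 4 ≤ T.card) :
    ∃ h ∈ T, Infers (T.erase h) x h := by
  have key : ∀ (T' : Finset (ι → ℝ)) (x' : ι → ℝ), T' ⊆ T → 8 * Fintype.card ι + 2 ≤ T'.card →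
      (∀ h ∈ T', 0 ≤ h ⬝ᵥ x') → ∃ h ∈ T, Infers (T.erase h) x' h := by
    intro T' x' hT' hc hx'
    obtain ⟨h, hh, hinf⟩ := exists_infers_of_nonneg (p := 8 * Fintype.card ι + 1)
      (fun h hh => hT h (hT' hh)) hc (by omega) hx'
    exact ⟨h, hT' hh, hinf.mono (Finset.erase_subset_erase _ hT')⟩
  -- One of the two sign classes has at least `8|ι| + 2` elements; negating `x` turns the negative
  -- class into a nonnegative one.
  have hsplit := Finset.card_filter_add_card_filter_not (s := T) fun h => 0 ≤ h ⬝ᵥ x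
  by_cases h : 8 * Fintype.card ι + 2 ≤ (T.filter fun h => 0 ≤ h ⬝ᵥ x).card
  · exact key _ x (Finset.filter_subset _ _) h fun h hh => (Finset.mem_filter.1 hh).2
  · obtain ⟨h, hh, hinf⟩ := key (T.filter fun h => ¬ 0 ≤ h ⬝ᵥ x) (-x) (Finset.filter_subset _ _)
      (by omega) fun h hh => by
        have := (Finset.mem_filter.1 hh).2
        rw [dotProduct_neg]
        linarith
    exact ⟨h, hh, hinf.of_neg⟩

end Infers

/-! ### Random samples infer at least half of the forms -/

section Sampling

open Classical in
/-- If every `d`-element set contains an element inferred from the others, then the sets that leave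
more than half of `V` undetermined become rare with growing size. -/
theorem card_bad_step {α : Type*} {V : Finset α} {I : Finset α → α → Prop} {d : ℕ}
    (hmono : ∀ S T v, S ⊆ T → I S v → I T v) (hmem : ∀ S, ∀ v ∈ S, I S v)
    (hdim : ∀ T ⊆ V, d ≤ T.card → ∃ v ∈ T, I (T.erase v) v) (i : ℕ) :
    ((V.powersetCard (i + 1)).filter
        fun S => V.card < 2 * (V.filter fun v => ¬ I S v).card).card * (i + 1 - d) ≤
      ((V.powersetCard i).filter
        fun S => V.card < 2 * (V.filter fun v => ¬ I S v).card).card * ((V.card - i) / 2) := by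
  -- Double counting of pairs of bad sets in which `X` is `S` plus one element inferred by `S`.
  -- Fewer than `d` elements of `X` are not inferred from the rest, and deleting an inferred one
  -- keeps the set bad. Conversely, a bad `S` infers less than half of `V`, including its own
  -- elements.
  refine Finset.card_mul_le_card_mul (fun X S => ∃ v ∉ S, I S v ∧ X = insert v S) ?_ ?_
  · intro X hX
    simp only [Finset.mem_filter, Finset.mem_powersetCard] at hX
    obtain ⟨⟨hXV, hXc⟩, hbad⟩ := hX
    have h1 : (X.filter fun v => ¬ I (X.erase v) v).card < d := by
      by_contra! hge
      obtain ⟨v, hv, hIv⟩ := hdim _ ((Finset.filter_subset _ _).trans hXV) hge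
      exact (Finset.mem_filter.1 hv).2
        (hmono _ _ _ (Finset.erase_subset_erase _ (Finset.filter_subset _ _)) hIv)
    have h2 := Finset.card_filter_add_card_filter_not (s := X) fun v => I (X.erase v) v
    calc i + 1 - d ≤ (X.filter fun v => I (X.erase v) v).card := by omega
      _ = ((X.filter fun v => I (X.erase v) v).image fun v => X.erase v).card := by
        refine (Finset.card_image_of_injOn fun v hv w hw hvw => ?_).symm
        simp only [Finset.coe_filter, Set.mem_ofPred_eq] at hv hw
        exact Finset.erase_injOn X hv.1 hw.1 hvw
      _ ≤ _ := by
        refine Finset.card_le_card fun S hS => ?_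
        obtain ⟨v, hv, rfl⟩ := Finset.mem_image.1 hS
        rw [Finset.mem_filter] at hv
        simp only [Finset.mem_bipartiteAbove, Finset.mem_filter, Finset.mem_powersetCard]
        refine ⟨⟨⟨(Finset.erase_subset _ _).trans hXV, by
          rw [Finset.card_erase_of_mem hv.1, hXc, Nat.add_sub_cancel]⟩, hbad.trans_le ?_⟩,
          v, Finset.notMem_erase _ _, hv.2, (Finset.insert_erase hv.1).symm⟩
        refine Nat.mul_le_mul_left 2 (Finset.card_le_card fun u hu => ?_)
        rw [Finset.mem_filter] at hu ⊢
        exact ⟨hu.1, fun hIu => hu.2 (hmono _ _ _ (Finset.erase_subset _ _) hIu)⟩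
  · intro S hS
    simp only [Finset.mem_filter, Finset.mem_powersetCard] at hS
    obtain ⟨⟨hSV, hSc⟩, hbad⟩ := hS
    have h1 := Finset.card_filter_add_card_filter_not (s := V) fun v => I S v
    have h2 : S.card + ((V \ S).filter fun v => I S v).card ≤ (V.filter fun v => I S v).card := by
      rw [← Finset.card_union_of_disjoint]
      · refine Finset.card_le_card fun v hv => ?_
        rcases Finset.mem_union.1 hv with hv | hv
        · exact Finset.mem_filter.2 ⟨hSV hv, hmem S v hv⟩
        · rw [Finset.mem_filter, Finset.mem_sdiff] at hv
          exact Finset.mem_filter.2 ⟨hv.1.1, hv.2⟩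
      · exact Finset.disjoint_left.2 fun v hv hv' =>
          (Finset.mem_sdiff.1 (Finset.mem_filter.1 hv').1).2 hv
    calc _ ≤ (((V \ S).filter fun v => I S v).image fun v => insert v S).card := by
          refine Finset.card_le_card fun X hX => ?_
          simp only [Finset.mem_bipartiteBelow, Finset.mem_filter, Finset.mem_powersetCard] at hX
          obtain ⟨⟨⟨hXV, -⟩, -⟩, v, hvS, hv, rfl⟩ := hX
          exact Finset.mem_image.2 ⟨v, Finset.mem_filter.2
            ⟨Finset.mem_sdiff.2 ⟨hXV (Finset.mem_insert_self _ _), hvS⟩, hv⟩, rfl⟩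
      _ ≤ ((V \ S).filter fun v => I S v).card := Finset.card_image_le
      _ ≤ (V.card - i) / 2 := by omega

open Classical in
-- One step of `card_bad_step` multiplies the proportion of bad sets by at most `(i + 1) / (2 (i + 1
-- - d))`, which is at most `3/4` once `i ≥ 3d`.
theorem card_bad_le {α : Type*} {V : Finset α} {I : Finset α → α → Prop} {d : ℕ}
    (hmono : ∀ S T v, S ⊆ T → I S v → I T v) (hmem : ∀ S, ∀ v ∈ S, I S v)
    (hdim : ∀ T ⊆ V, d ≤ T.card → ∃ v ∈ T, I (T.erase v) v) (k : ℕ) :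
    ((V.powersetCard (3 * d + k)).filter
        fun S => V.card < 2 * (V.filter fun v => ¬ I S v).card).card * 4 ^ k ≤
      3 ^ k * V.card.choose (3 * d + k) := by
  induction k with
  | zero =>
    simp only [Nat.add_zero, pow_zero, mul_one, one_mul]
    exact (Finset.card_filter_le _ _).trans (Finset.card_powersetCard _ _).le
  | succ k ih =>
    have hstep := card_bad_step hmono hmem hdim (3 * d + k)
    rw [← Nat.add_assoc]
    set i := 3 * d + k with hi
    set b := ((V.powersetCard i).filter
        fun S => V.card < 2 * (V.filter fun v => ¬ I S v).card).card
    set b' := ((V.powersetCard (i + 1)).filter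
        fun S => V.card < 2 * (V.filter fun v => ¬ I S v).card).card
    have h1 : 4 * (b' * (i + 1)) ≤ 3 * (b * (V.card - i)) := by
      have h2 : 2 * (i + 1) ≤ 3 * (i + 1 - d) := by omega
      have h3 : (V.card - i) / 2 * 2 ≤ V.card - i := Nat.div_mul_le_self _ _
      calc 4 * (b' * (i + 1)) = 2 * (b' * (2 * (i + 1))) := by ring
        _ ≤ 2 * (b' * (3 * (i + 1 - d))) := by gcongr
        _ = 6 * (b' * (i + 1 - d)) := by ring
        _ ≤ 6 * (b * ((V.card - i) / 2)) := by gcongr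
        _ = 3 * (b * ((V.card - i) / 2 * 2)) := by ring
        _ ≤ _ := by gcongr
    refine Nat.le_of_mul_le_mul_right (c := i + 1) ?_ (Nat.succ_pos i)
    calc b' * 4 ^ (k + 1) * (i + 1) = 4 * (b' * (i + 1)) * 4 ^ k := by ring
      _ ≤ 3 * (b * (V.card - i)) * 4 ^ k := by gcongr
      _ = 3 * (V.card - i) * (b * 4 ^ k) := by ring
      _ ≤ 3 * (V.card - i) * (3 ^ k * V.card.choose i) := by gcongr
      _ = 3 ^ (k + 1) * (V.card.choose i * (V.card - i)) := by ring
      _ = 3 ^ (k + 1) * V.card.choose (i + 1) * (i + 1) := by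
        rw [← Nat.choose_succ_right_eq]
        ring

open Classical in
/-- One small set `S` leaves at most half of `V` undetermined, for all but a fraction `2⁻ⁿ` of the
points of `X`. -/
theorem exists_good_sample {α β : Type*} {V : Finset α} {X : Finset β}
    {I : β → Finset α → α → Prop} {d : ℕ}
    (hmono : ∀ x S T v, S ⊆ T → I x S v → I x T v) (hmem : ∀ x S, ∀ v ∈ S, I x S v)
    (hdim : ∀ x, ∀ T ⊆ V, d ≤ T.card → ∃ v ∈ T, I x (T.erase v) v) (n : ℕ) :
    ∃ S ⊆ V, S.card ≤ 3 * d + 3 * n ∧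
      (X.filter fun x => V.card < 2 * (V.filter fun v => ¬ I x S v).card).card * 2 ^ n ≤
        X.card := by
  by_cases hV : V.card ≤ 3 * d + 3 * n
  · refine ⟨V, subset_rfl, hV, ?_⟩
    rw [Finset.filter_false_of_mem, Finset.card_empty]
    · omega
    · intro x _
      rw [Finset.filter_false_of_mem fun v hv => not_not.2 (hmem x V v hv)]
      simp
  push Not at hV
  by_contra! hno
  have hne : (V.powersetCard (3 * d + 3 * n)).Nonempty := Finset.powersetCard_nonempty.2 hV.le
  have h1 : ∀ S ∈ V.powersetCard (3 * d + 3 * n), X.card <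
      (X.filter fun x => V.card < 2 * (V.filter fun v => ¬ I x S v).card).card * 2 ^ n := by
    intro S hS
    rw [Finset.mem_powersetCard] at hS
    exact hno S hS.1 hS.2.le
  have h2 := Finset.sum_lt_sum_of_nonempty hne h1
  rw [Finset.sum_const, Finset.card_powersetCard, smul_eq_mul, ← Finset.sum_mul] at h2
  -- Exchange of summation: bad samples are rare at each point, so some sample is bad at few points.
  have h3 := Finset.sum_card_bipartiteAbove_eq_sum_card_bipartiteBelow
    (s := V.powersetCard (3 * d + 3 * n)) (t := X)
    fun S x => V.card < 2 * (V.filter fun v => ¬ I x S v).card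
  simp only [Finset.bipartiteAbove, Finset.bipartiteBelow] at h3
  rw [h3, Finset.sum_mul] at h2
  refine h2.not_ge ?_
  rw [mul_comm (Nat.choose _ _), ← smul_eq_mul X.card, ← Finset.sum_const]
  refine Finset.sum_le_sum fun x _ => ?_
  have h4 := card_bad_le (hmono x) (hmem x) (hdim x) (3 * n)
  -- With `27 ≤ 32` this gives `(3/4) ^ (3n) ≤ 2⁻ⁿ`.
  have h5 : (4 : ℕ) ^ (3 * n) = 2 ^ n * 32 ^ n := by
    rw [pow_mul, ← mul_pow]
    norm_num
  refine Nat.le_of_mul_le_mul_right (c := 32 ^ n) ?_ (by positivity)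
  rw [mul_assoc, ← h5]
  refine h4.trans ?_
  rw [mul_comm, pow_mul]
  gcongr
  norm_num

end Sampling

/-! ### Colourings that keep differences of forms in `{-1, 0, 1}` -/

section Colouring

variable {ι : Type} [Fintype ι]

/-- The signs of the coefficients of `h` are compatible with the colouring `s`. -/
def Compatible {ι : Type} (s : ι → Bool) (h : ι → ℝ) : Prop :=
  ∀ c, (s c = true ∧ 0 ≤ h c) ∨ (s c = false ∧ h c ≤ 0)

open Classical in
-- Only colours on the support of `h` are forced, so a uniformly random colouring is compatible with
-- probability at least `2⁻⁴`.
theorem card_compatible {h : ι → ℝ} (hh : (Finset.univ.filter fun c => h c ≠ 0).card ≤ 4) :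
    2 ^ Fintype.card ι ≤ (Finset.univ.filter fun s => Compatible s h).card * 16 := by
  have heq : (Finset.univ.filter fun s => Compatible s h) = Fintype.piFinset fun c =>
      Finset.univ.filter fun b : Bool => (b = true ∧ 0 ≤ h c) ∨ (b = false ∧ h c ≤ 0) := by
    ext s
    rw [Finset.mem_filter_univ, Fintype.mem_piFinset]
    simp [Compatible]
  have h2 : ∀ c, 2 ≤ (Finset.univ.filter fun b : Bool =>
      (b = true ∧ 0 ≤ h c) ∨ (b = false ∧ h c ≤ 0)).card * if h c ≠ 0 then 2 else 1 := by
    intro c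
    rcases lt_trichotomy (h c) 0 with h0 | h0 | h0
    · have : (Finset.univ.filter fun b : Bool =>
          (b = true ∧ 0 ≤ h c) ∨ (b = false ∧ h c ≤ 0)) = {false} := by
        ext b
        cases b <;> simp [h0, h0.le]
      rw [this]
      simp [h0.ne]
    · simp [h0]
    · have : (Finset.univ.filter fun b : Bool =>
          (b = true ∧ 0 ≤ h c) ∨ (b = false ∧ h c ≤ 0)) = {true} := by
        ext b
        cases b <;> simp [h0, h0.le]
      rw [this]
      simp [h0.ne']
  calc 2 ^ Fintype.card ι = ∏ _c : ι, 2 := by simp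
    _ ≤ _ := Finset.prod_le_prod' fun c _ => h2 c
    _ = (Finset.univ.filter fun s => Compatible s h).card *
        2 ^ (Finset.univ.filter fun c => h c ≠ 0).card := by
      rw [Finset.prod_mul_distrib, heq, Fintype.card_piFinset, Finset.prod_ite]
      simp
    _ ≤ _ := by
      gcongr
      calc _ ≤ 2 ^ 4 := Nat.pow_le_pow_right two_pos hh
        _ = 16 := by norm_num

open Classical in
/-- Some colouring is compatible with a constant fraction of given sparse vectors. -/
theorem exists_colouring {R : Finset (ι → ℝ)}
    (hR : ∀ h ∈ R, (Finset.univ.filter fun c => h c ≠ 0).card ≤ 4) :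
    ∃ s : ι → Bool, R.card ≤ 16 * (R.filter fun h => Compatible s h).card := by
  by_contra! hno
  have h1 := Finset.sum_lt_sum_of_nonempty (s := (Finset.univ : Finset (ι → Bool)))
    Finset.univ_nonempty fun s _ => hno s
  have h3 := Finset.sum_card_bipartiteAbove_eq_sum_card_bipartiteBelow
    (s := (Finset.univ : Finset (ι → Bool))) (t := R) fun s h => Compatible s h
  simp only [Finset.bipartiteAbove, Finset.bipartiteBelow] at h3
  rw [← Finset.mul_sum, h3, Finset.sum_const, Finset.card_univ, smul_eq_mul, Fintype.card_fun,
    Fintype.card_bool, mul_comm (2 ^ _), ← smul_eq_mul R.card, ← Finset.sum_const,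
    Finset.mul_sum] at h1
  refine h1.not_ge (Finset.sum_le_sum fun h hh => ?_)
  rw [mul_comm]
  exact card_compatible (hR h hh)

end Colouring

/-- Under a common colouring the two coefficients at `c` never have opposite signs, so their
difference cannot be `±2`. -/
theorem Compatible.sub_coeff {ι : Type} {s : ι → Bool} {g h : ι → ℝ} (hg : Compatible s g)
    (hh : Compatible s h) (hg1 : ∀ c, g c = -1 ∨ g c = 0 ∨ g c = 1)
    (hh1 : ∀ c, h c = -1 ∨ h c = 0 ∨ h c = 1) (c : ι) :
    (g - h) c = -1 ∨ (g - h) c = 0 ∨ (g - h) c = 1 := by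
  rw [Pi.sub_apply]
  rcases hg c with ⟨a, b⟩ | ⟨a, b⟩ <;> rcases hh c with ⟨a', b'⟩ | ⟨a', b'⟩ <;>
    rcases hg1 c with e | e | e <;> rcases hh1 c with e' | e' | e' <;>
    simp_all <;> norm_num at *

/-! ### Point location by rounds -/

section Rounds

variable {ι : Type} [Fintype ι]

/-- Inference at a point depends only on the order and signs of `S` there, so a single point speaks
for a whole region once `S` is sorted. -/
theorem Infers.congr {S : Finset (ι → ℝ)} {x y h : ι → ℝ} (H : Infers S x h)
    (hS : SameOrder S x y) (hS' : ∀ g ∈ S, SignType.sign (g ⬝ᵥ x) = SignType.sign (g ⬝ᵥ y)) :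
    Infers S y h := fun w hw hw' =>
  (H y hS hS').symm.trans (H w (hS.trans hw) fun g hg => (hS' g hg).trans (hw' g hg))

open Classical in
theorem exists_int_coeff {h : ι → ℝ} (h1 : ∀ c, h c = -1 ∨ h c = 0 ∨ h c = 1)
    (h4 : (Finset.univ.filter fun c => h c ≠ 0).card ≤ 4) :
    ∃ z : ι → ℤ, (h = fun c => (z c : ℝ)) ∧ ∑ c, (z c).natAbs ≤ 4 := by
  have : ∀ c, ∃ z : ℤ, h c = z ∧ z.natAbs ≤ if h c ≠ 0 then 1 else 0 := by
    intro c
    rcases h1 c with e | e | e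
    · exact ⟨-1, by simp [e], by simp [e]⟩
    · exact ⟨0, by simp [e], by simp [e]⟩
    · exact ⟨1, by simp [e], by simp [e]⟩
  choose z hz hz' using this
  refine ⟨z, funext hz, (Finset.sum_le_sum fun c _ => hz' c).trans ?_⟩
  rwa [← Finset.card_filter]

open Classical in
/-- Point location by rounds: a round sorts a small sample of the forms `R` whose signs are still
open; it determines a constant fraction of `R` or discards all but a fraction `2⁻ⁿ` of `X`. -/
theorem refinable_rounds {H : Finset (ι → ℝ)} {Q : Set (ι → ℝ)} {n m κ : ℕ} (h0 : 0 ∈ H)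
    (h1 : ∀ h ∈ H, ∀ c, h c = -1 ∨ h c = 0 ∨ h c = 1)
    (h4 : ∀ h ∈ H, (Finset.univ.filter fun c => h c ≠ 0).card ≤ 4)
    (hQ : ∀ g ∈ H, ∀ h ∈ H, (∀ c, (g - h) c = -1 ∨ (g - h) c = 0 ∨ (g - h) c = 1) → g - h ∈ Q)
    (hm : 3 * (16 * Fintype.card ι + 4) + 3 * n + 1 ≤ m) (hκ : m ≤ 2 ^ κ) :
    ∀ (t k r : ℕ) (X R : Finset (ι → ℝ)), k + r = t → R ⊆ H → X.card ≤ (2 ^ n) ^ k →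
      (R.card : ℝ) < (32 / 31) ^ r →
      (∀ h ∈ H, h ∉ R → ∀ x ∈ X, ∀ y ∈ X, SignType.sign (h ⬝ᵥ x) = SignType.sign (h ⬝ᵥ y)) →
      Refinable Q (fun Y => ∀ h ∈ H, ∀ x ∈ Y, ∀ y ∈ Y,
        SignType.sign (h ⬝ᵥ x) = SignType.sign (h ⬝ᵥ y)) (t * (m * κ)) X := by
  intro t
  induction t with
  | zero =>
    intro k r X R hkr _ hX _ _
    obtain rfl : k = 0 := by omega
    refine .done fun h _ x hx y hy => ?_
    rw [Finset.card_le_one.1 (by simpa using hX) x hx y hy]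
  | succ t ih =>
    intro k r X R hkr hRH hX hR hXR
    -- `k` bounds the rounds that can still shrink `X`, and `r` those that can still shrink `R`. At
    -- `k = 0` at most one point is left, at `r = 0` no open form.
    rcases k with _ | k
    · refine .done fun h _ x hx y hy => ?_
      rw [Finset.card_le_one.1 (by simpa using hX) x hx y hy]
    rcases r with _ | r
    · obtain rfl : R = ∅ := by
        rw [pow_zero, Nat.cast_lt_one] at hR
        exact Finset.card_eq_zero.1 hR
      exact .done fun h hh => hXR h hh (by simp)
    obtain ⟨s, hs⟩ := exists_colouring fun h hh => h4 h (hRH hh)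
    set V := R.filter fun h => Compatible s h
    have hVR : V ⊆ R := Finset.filter_subset _ _
    obtain ⟨S, hSV, hSc, hbad⟩ := exists_good_sample (V := V) (X := X)
      (I := fun x S h => Infers S x h) (d := 16 * Fintype.card ι + 4) (fun _ _ _ _ hST hI => hI.mono hST)
      (fun _ _ _ hv => Infers.of_mem hv)
      (fun x T hT hTc => by
        convert exists_infers x (fun h hh => exists_int_coeff (h1 h (hRH (hVR (hT hh))))
          (h4 h (hRH (hVR (hT hh))))) hTc) n
    -- Sorting `0` along with `S` also yields the signs of the forms in `S`; `0` is compatible with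
    -- every colouring.
    have hS0 : ∀ g ∈ insert 0 S, g ∈ H ∧ Compatible s g := by
      intro g hg
      rcases Finset.mem_insert.1 hg with rfl | hg
      · exact ⟨h0, fun c => by cases s c <;> simp⟩
      · exact ⟨hRH (hVR (hSV hg)), (Finset.mem_filter.1 (hSV hg)).2⟩
    have hcard : (insert 0 S).card ≤ m := (Finset.card_insert_le _ _).trans (by omega)
    have hsort := refinable_sort (Q := Q) (k := κ) (insert 0 S) (fun g hg h hh =>
      hQ g (hS0 g hg).1 h (hS0 h hh).1 ((hS0 g hg).2.sub_coeff (hS0 h hh).2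
        (h1 g (hS0 g hg).1) (h1 h (hS0 h hh).1))) (hcard.trans hκ) X
    rw [Nat.add_mul, one_mul, Nat.add_comm]
    refine (hsort.mono_depth (Nat.mul_le_mul_right κ hcard)).bind fun Y hYX hY => ?_
    rcases Y.eq_empty_or_nonempty with rfl | ⟨x₀, hx₀⟩
    · exact .done (by simp)
    have hYS : ∀ y ∈ Y, SameOrder S x₀ y := fun y hy =>
      (hY x₀ hx₀ y hy).mono (Finset.subset_insert _ _)
    have hYS' : ∀ y ∈ Y, ∀ g ∈ S, SignType.sign (g ⬝ᵥ x₀) = SignType.sign (g ⬝ᵥ y) := by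
      intro y hy g hg
      have := hY x₀ hx₀ y hy g (Finset.mem_insert_of_mem hg) 0 (Finset.mem_insert_self _ _)
      rwa [sub_zero] at this
    -- Whether the sample is bad is constant on `Y`. If it is bad, `Y` lies in the rare bad part of
    -- `X` and `k` drops; otherwise `r` drops.
    by_cases hx₀bad : V.card < 2 * (V.filter fun h => ¬ Infers S x₀ h).card
    · refine ih k (r + 1) Y R (by omega) hRH ?_ hR fun h hh hhR x hx y hy =>
        hXR h hh hhR x (hYX hx) y (hYX hy)
      have hsub : Y ⊆ X.filter fun x => V.card < 2 * (V.filter fun h => ¬ Infers S x h).card := by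
        refine fun y hy => Finset.mem_filter.2 ⟨hYX hy, hx₀bad.trans_le ?_⟩
        refine Nat.mul_le_mul_left 2 (Finset.card_le_card fun h hh => ?_)
        rw [Finset.mem_filter] at hh ⊢
        exact ⟨hh.1, fun hI => hh.2 (hI.congr (hYS y hy).symm fun g hg => (hYS' y hy g hg).symm)⟩
      refine Nat.le_of_mul_le_mul_right (c := 2 ^ n) ?_ (by positivity)
      calc _ ≤ _ := Nat.mul_le_mul_right _ (Finset.card_le_card hsub)
        _ ≤ X.card := hbad
        _ ≤ _ := by rwa [← pow_succ]
    · set R' := R.filter fun h => ¬ ∀ y ∈ Y, SignType.sign (h ⬝ᵥ x₀) = SignType.sign (h ⬝ᵥ y)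
        with hR'
      refine ih (k + 1) r Y R' (by omega) ((Finset.filter_subset _ _).trans hRH)
        ((Finset.card_le_card hYX).trans hX) ?_ ?_
      · have e1 := Finset.card_filter_add_card_filter_not (s := R) fun h =>
          ∀ y ∈ Y, SignType.sign (h ⬝ᵥ x₀) = SignType.sign (h ⬝ᵥ y)
        have e2 := Finset.card_filter_add_card_filter_not (s := V) fun h => Infers S x₀ h
        have e3 : (V.filter fun h => Infers S x₀ h).card ≤ (R.filter fun h =>
            ∀ y ∈ Y, SignType.sign (h ⬝ᵥ x₀) = SignType.sign (h ⬝ᵥ y)).card := by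
          refine Finset.card_le_card fun h hh => ?_
          rw [Finset.mem_filter] at hh ⊢
          exact ⟨hVR hh.1, fun y hy => hh.2 y (hYS y hy) (hYS' y hy)⟩
        -- `V` has at least `|R| / 16` elements, and at least half of them are inferred.
        have e4 : 32 * R'.card ≤ 31 * R.card := by
          rw [hR']
          omega
        have e5 : (32 : ℝ) * R'.card ≤ 31 * R.card := by exact_mod_cast e4
        rw [pow_succ] at hR
        linarith
      · intro h hh hhR' x hx y hy
        by_cases hhR : h ∈ R
        · have : ∀ y ∈ Y, SignType.sign (h ⬝ᵥ x₀) = SignType.sign (h ⬝ᵥ y) := by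
            by_contra hne
            exact hhR' (Finset.mem_filter.2 ⟨hhR, hne⟩)
          rw [← this x hx, this y hy]
        · exact hXR h hh hhR x (hYX hx) y (hYX hy)

end Rounds

/-! ### Comparison vectors of sums, and reading off the sorted sumset -/

section Sumset

theorem sumComparison_dotProduct {n : ℕ} (i j k l : Fin n) (a b : Fin n → ℝ) :
    sumComparison i j k l ⬝ᵥ Sum.elim a b = a i + b j - (a k + b l) := by
  simp [sumComparison, sub_dotProduct, add_dotProduct]

theorem sumComparison_coeff {n : ℕ} (i j k l : Fin n) (c : Fin n ⊕ Fin n) :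
    sumComparison i j k l c = -1 ∨ sumComparison i j k l c = 0 ∨ sumComparison i j k l c = 1 := by
  rcases c with c | c <;> simp only [sumComparison, Pi.sub_apply, Pi.add_apply, Pi.single_apply] <;>
    simp only [Sum.inl.injEq, Sum.inr.injEq, reduceCtorEq, if_false] <;> split_ifs <;> simp

open Classical in
theorem card_support_sumComparison {n : ℕ} (i j k l : Fin n) :
    (Finset.univ.filter fun c => sumComparison i j k l c ≠ 0).card ≤ 4 := by
  have : (Finset.univ.filter fun c => sumComparison i j k l c ≠ 0) ⊆
      {Sum.inl i, Sum.inr j, Sum.inl k, Sum.inr l} := by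
    intro c hc
    rw [Finset.mem_filter] at hc
    by_contra hn
    simp only [Finset.mem_insert, Finset.mem_singleton, not_or] at hn
    exact hc.2 (by simp [sumComparison, hn])
  exact (Finset.card_le_card this).trans Finset.card_le_four

open Classical in
theorem isSparse_sub {ι : Type} [Fintype ι] {g h : ι → ℝ}
    (hg : (Finset.univ.filter fun c => g c ≠ 0).card ≤ 4)
    (hh : (Finset.univ.filter fun c => h c ≠ 0).card ≤ 4) : IsSparse 8 (g - h) := by
  have hsub : Function.support (g - h) ⊆ ↑((Finset.univ.filter fun c => g c ≠ 0) ∪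
      Finset.univ.filter fun c => h c ≠ 0) := by
    intro c hc
    simp only [Finset.coe_union, Finset.coe_filter, Finset.mem_univ, true_and, Set.mem_union,
      Set.mem_ofPred_eq]
    by_contra! hn
    exact hc (by simp [hn.1, hn.2])
  refine (Set.encard_le_encard hsub).trans ?_
  rw [Set.encard_coe_eq_coe_finsetCard]
  exact Nat.cast_le.2 ((Finset.card_union_le _ _).trans (Nat.add_le_add hg hh))

/-- The comparisons of sums determine a sorted list of the sumset. -/
theorem exists_sumset_order (n : ℕ) :
    ∃ order : (sumsetVectors n → SignType) → List (Fin n × Fin n), ∀ a b : Fin n → ℝ,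
      (order (pointLocation (sumsetVectors n) (Sum.elim a b))).map (fun p => a p.1 + b p.2) =
        (Finset.univ.image a + Finset.univ.image b).sort (· ≤ ·) := by
  have hsign : ∀ a b a' b' : Fin n → ℝ, pointLocation (sumsetVectors n) (Sum.elim a b) =
      pointLocation (sumsetVectors n) (Sum.elim a' b') → ∀ p q : Fin n × Fin n,
      SignType.sign (a p.1 + b p.2 - (a q.1 + b q.2)) =
        SignType.sign (a' p.1 + b' p.2 - (a' q.1 + b' q.2)) := by
    intro a b a' b' h p q
    have := congrFun h ⟨sumComparison p.1 p.2 q.1 q.2, p.1, p.2, q.1, q.2, rfl⟩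
    simpa only [pointLocation, sumComparison_dotProduct] using this
  have hmem : ∀ (a b : Fin n → ℝ) (z : ℝ), z ∈ Finset.univ.image a + Finset.univ.image b ↔
      ∃ p : Fin n × Fin n, a p.1 + b p.2 = z := by
    intro a b z
    simp [Finset.mem_add]
  have key : ∀ σ : sumsetVectors n → SignType, ∃ L : List (Fin n × Fin n), ∀ a b : Fin n → ℝ,
      pointLocation (sumsetVectors n) (Sum.elim a b) = σ →
      L.map (fun p => a p.1 + b p.2) =
        (Finset.univ.image a + Finset.univ.image b).sort (· ≤ ·) := by
    intro σ
    by_cases hσ : ∃ a b : Fin n → ℝ, pointLocation (sumsetVectors n) (Sum.elim a b) = σ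
    · obtain ⟨a, b, rfl⟩ := hσ
      -- One input realising `σ` supplies index pairs for its own sorted sumset. Any other input
      -- with the same signs has the same strict inequalities and coincidences among sums, so the
      -- same list works. Unrealised `σ` get the empty list.
      obtain ⟨L, hL⟩ : (Finset.univ.image a + Finset.univ.image b).sort (· ≤ ·) ∈
          Set.range (List.map fun p : Fin n × Fin n => a p.1 + b p.2) := by
        rw [Set.range_list_map]
        intro z hz
        rw [Finset.mem_sort, hmem] at hz
        exact hz
      refine ⟨L, fun a' b' h => ?_⟩
      have hlt : (L.map fun p => a' p.1 + b' p.2).Pairwise (· < ·) := by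
        have h1 := Finset.sortedLT_sort (Finset.univ.image a + Finset.univ.image b)
        rw [← hL] at h1
        have h2 := List.pairwise_map.1 h1.pairwise
        refine List.pairwise_map.2 (h2.imp fun {p q} hpq => ?_)
        rw [← sub_neg, ← sign_eq_neg_one_iff, hsign a' b' a b h, sign_eq_neg_one_iff, sub_neg]
        exact hpq
      have hset : (L.map fun p => a' p.1 + b' p.2).toFinset =
          Finset.univ.image a' + Finset.univ.image b' := by
        ext z
        rw [List.mem_toFinset, List.mem_map, hmem]
        refine ⟨fun ⟨p, _, hp⟩ => ⟨p, hp⟩, fun ⟨p, hp⟩ => ?_⟩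
        have h1 : a p.1 + b p.2 ∈ L.map fun p => a p.1 + b p.2 := by
          rw [hL, Finset.mem_sort, hmem]
          exact ⟨p, rfl⟩
        obtain ⟨q, hq, hqp⟩ := List.mem_map.1 h1
        refine ⟨q, hq, ?_⟩
        rw [← hp, ← sub_eq_zero, ← sign_eq_zero_iff, hsign a' b' a b h, sign_eq_zero_iff,
          sub_eq_zero]
        exact hqp
      rw [← hset]
      exact ((List.toFinset_sort (· ≤ ·) (hlt.imp fun h => h.ne)).2 (hlt.imp fun h => h.le)).symm
    · exact ⟨[], fun a b h => absurd ⟨a, b, h⟩ hσ⟩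
  choose order horder using key
  exact ⟨order, fun a b => horder _ a b rfl⟩

end Sumset

/-! ### The tree for sumsets and its depth -/

section PointLocation

open Classical in
/-- A shallow comparison tree for the comparisons of sums, with its depth in terms of `⌈log₂ n⌉`. -/
theorem exists_sumset_tree {n : ℕ} (hn : 2 ≤ n) :
    ∃ T : LinearDecisionTree (Fin n ⊕ Fin n) (sumsetVectors n → SignType),
      T.depth ≤ 95824 * (n * Nat.clog 2 n ^ 2) ∧
      (∀ q ∈ T.queries, ∃ g ∈ sumsetVectors n, ∃ h ∈ sumsetVectors n, q = g - h ∧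
        ∀ c, q c = -1 ∨ q c = 0 ∨ q c = 1) ∧
      ∀ x, T.eval x = pointLocation (sumsetVectors n) x := by
  set H : Finset (Fin n ⊕ Fin n → ℝ) := Finset.univ.image
    fun p : (Fin n × Fin n) × (Fin n × Fin n) => sumComparison p.1.1 p.1.2 p.2.1 p.2.2
  have hH : ∀ h, h ∈ H ↔ h ∈ sumsetVectors n := by
    intro h
    simp [H, sumsetVectors, eq_comm]
  have hHcard : H.card ≤ n ^ 4 := by
    refine Finset.card_image_le.trans (le_of_eq ?_)
    simp only [Finset.card_univ, Fintype.card_prod, Fintype.card_fin]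
    ring
  have h0 : (0 : Fin n ⊕ Fin n → ℝ) ∈ H :=
    (hH 0).2 ⟨⟨0, by omega⟩, ⟨0, by omega⟩, ⟨0, by omega⟩, ⟨0, by omega⟩, by simp [sumComparison]⟩
  have h1 : ∀ h ∈ H, ∀ c, h c = -1 ∨ h c = 0 ∨ h c = 1 := by
    intro h hh
    obtain ⟨i, j, k, l, rfl⟩ := (hH h).1 hh
    exact sumComparison_coeff i j k l
  have h4 : ∀ h ∈ H, (Finset.univ.filter fun c => h c ≠ 0).card ≤ 4 := by
    intro h hh
    obtain ⟨i, j, k, l, rfl⟩ := (hH h).1 hh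
    exact card_support_sumComparison i j k l
  set Q : Set (Fin n ⊕ Fin n → ℝ) := {q | ∃ g ∈ sumsetVectors n, ∃ h ∈ sumsetVectors n,
    q = g - h ∧ ∀ c, q c = -1 ∨ q c = 0 ∨ q c = 1}
  set E : Finset (Fin n ⊕ Fin n → ℝ) := Finset.image₂ (fun g h => g - h) H H
  have hEcard : E.card ≤ n ^ 8 := by
    calc E.card ≤ H.card * H.card := Finset.card_image₂_le _ _ _
      _ ≤ n ^ 4 * n ^ 4 := Nat.mul_le_mul hHcard hHcard
      _ = n ^ 8 := by ring
  -- `E` contains every query the tree may ask, so a tree that is correct on `P` is correct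
  -- everywhere.
  obtain ⟨P, hPc, hP⟩ := exists_sign_representatives E ⊤
  set L := Nat.clog 2 n with hL
  have hL1 : 1 ≤ L := Nat.clog_pos one_lt_two hn
  have hnL : n ≤ 2 ^ L := Nat.le_pow_clog one_lt_two n
  have hP' : P.card ≤ (2 ^ n) ^ (20 * L) := by
    rw [finrank_top, Module.finrank_fintype_fun_eq_card, Fintype.card_sum, Fintype.card_fin] at hPc
    calc P.card ≤ (3 * E.card + 1) ^ (n + n) := hPc
      _ ≤ (n ^ 10) ^ (n + n) := by
        refine Nat.pow_le_pow_left ?_ _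
        have h2 : 1 ≤ n ^ 8 := Nat.one_le_pow _ _ (by omega)
        calc 3 * E.card + 1 ≤ 2 ^ 2 * n ^ 8 := by omega
          _ ≤ n ^ 2 * n ^ 8 := by gcongr
          _ = n ^ 10 := by ring
      _ ≤ ((2 ^ L) ^ 10) ^ (n + n) := by gcongr
      _ = (2 ^ n) ^ (20 * L) := by
        rw [← pow_mul, ← pow_mul, ← pow_mul]
        congr 1
        ring
  -- `92 = 4 * 23`: there are at most `n ^ 4 ≤ 2 ^ (4L)` forms and `2 ≤ (32/31) ^ 23`. The extra `1`
  -- makes the inequality strict.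
  have hR : (H.card : ℝ) < (32 / 31) ^ (92 * L + 1) := by
    have h2 : (2 : ℝ) ≤ (32 / 31) ^ 23 := by norm_num
    calc (H.card : ℝ) ≤ ((n ^ 4 : ℕ) : ℝ) := by exact_mod_cast hHcard
      _ ≤ (((2 ^ L) ^ 4 : ℕ) : ℝ) := by exact_mod_cast Nat.pow_le_pow_left hnL 4
      _ = 2 ^ (4 * L) := by
        push_cast
        rw [← pow_mul, mul_comm]
      _ ≤ ((32 / 31) ^ 23) ^ (4 * L) := by gcongr
      _ = (32 / 31) ^ (92 * L) := by
        rw [← pow_mul]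
        congr 1
        ring
      _ < _ := pow_lt_pow_right₀ (by norm_num) (by omega)
  -- The left side is `99n + 13`, which is at most `106n` because `n ≥ 2`.
  have hm : 3 * (16 * Fintype.card (Fin n ⊕ Fin n) + 4) + 3 * n + 1 ≤ 106 * n := by
    rw [Fintype.card_sum, Fintype.card_fin]
    omega
  have hκ : 106 * n ≤ 2 ^ (L + 7) := by
    rw [pow_add]
    omega
  have hmain := refinable_rounds (Q := Q) h0 h1 h4 (fun g hg h hh hc =>
    ⟨g, (hH g).1 hg, h, (hH h).1 hh, rfl, hc⟩) hm hκ (20 * L + (92 * L + 1)) (20 * L) (92 * L + 1)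
    P H rfl subset_rfl hP' hR fun h hh hh' => absurd hh hh'
  have hfin : Refinable Q (fun Y => ∃ o, ∀ x ∈ Y, pointLocation (sumsetVectors n) x = o)
      ((20 * L + (92 * L + 1)) * (106 * n * (L + 7)) + 0) P := by
    refine hmain.bind fun Y _ hY => .done ?_
    rcases Y.eq_empty_or_nonempty with rfl | ⟨y, hy⟩
    · exact ⟨fun _ => 0, by simp⟩
    · exact ⟨_, fun x hx => funext fun h => hY h.1 ((hH _).2 h.2) x hx y hy⟩
  obtain ⟨T, hTd, hTQ, hT⟩ := hfin.exists_tree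
  refine ⟨T, hTd.trans ?_, fun q hq => hTQ hq, fun x => ?_⟩
  -- The constant is `95824 = 113 * 106 * 8`, using `1 ≤ L`.
  · calc (20 * L + (92 * L + 1)) * (106 * n * (L + 7)) + 0
        ≤ (113 * L) * (106 * n * (8 * L)) := by
          rw [Nat.add_zero]
          exact Nat.mul_le_mul (by omega) (Nat.mul_le_mul_left _ (by omega))
      _ = _ := by ring
  · obtain ⟨p, hp, -, hpE⟩ := hP x Submodule.mem_top
    have hsign : ∀ g ∈ sumsetVectors n, ∀ h ∈ sumsetVectors n,
        SignType.sign ((g - h) ⬝ᵥ x) = SignType.sign ((g - h) ⬝ᵥ p) := fun g hg h hh =>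
      hpE _ (Finset.mem_image₂_of_mem ((hH g).2 hg) ((hH h).2 hh))
    rw [T.eval_eq_of_sign_eq (y := p), hT p hp]
    · funext h
      have := hsign h.1 h.2 0 ((hH 0).1 h0)
      rw [sub_zero] at this
      exact this.symm
    · intro q hq
      obtain ⟨g, hg, h, hh, rfl, -⟩ := hTQ hq
      exact hsign g hg h hh

/-- Rounding up costs at most `log 2 ≤ log n`, so the product of `Nat.clog 2 n` and `log 2` is at
most `2 log n`; and `log 2 > 2/3`. -/
theorem clog_two_le_three_mul_log {n : ℕ} (hn : 2 ≤ n) : (Nat.clog 2 n : ℝ) ≤ 3 * Real.log n := by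
  have h1 : 2 ^ (Nat.clog 2 n - 1) ≤ n := (Nat.pow_pred_clog_lt_self one_lt_two hn).le
  have hlog2 : Real.log 2 ≤ Real.log n := Real.log_le_log two_pos (by exact_mod_cast hn)
  have h2 : ((Nat.clog 2 n - 1 : ℕ) : ℝ) * Real.log 2 ≤ Real.log n := by
    rw [← Real.log_pow]
    exact Real.log_le_log (by positivity) (by exact_mod_cast h1)
  have h3 : 1 ≤ Nat.clog 2 n := Nat.clog_pos one_lt_two hn
  rw [Nat.cast_sub h3, Nat.cast_one, sub_mul, one_mul] at h2
  have h4 := Real.log_two_gt_d9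
  have h5 : (0 : ℝ) ≤ Nat.clog 2 n := Nat.cast_nonneg _
  nlinarith

end PointLocation

theorem mainTheorem6 :
    ∃ C : ℝ, 0 < C ∧ ∀ n : ℕ,
      ∃ T : LinearDecisionTree (Fin n ⊕ Fin n) (sumsetVectors n → SignType),
        T.IsComparisonTree (sumsetVectors n) ∧
        (∀ q ∈ T.queries, IsSparse 8 q ∧ ∀ c, q c = -1 ∨ q c = 0 ∨ q c = 1) ∧
        (T.depth : ℝ) ≤ C * n * Real.log n ^ 2 ∧
        (∀ x : Fin n ⊕ Fin n → ℝ, T.eval x = pointLocation (sumsetVectors n) x) ∧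
        ∃ order : (sumsetVectors n → SignType) → List (Fin n × Fin n),
          ∀ A B : Finset ℝ, A.card = n → B.card = n →
            ∀ a b : Fin n → ℝ, Finset.univ.image a = A → Finset.univ.image b = B →
              (order (T.eval (Sum.elim a b))).map (fun p => a p.1 + b p.2)
                = (A + B).sort (· ≤ ·) := by
  -- The factor `9` is the square of the `3` in `clog_two_le_three_mul_log`.
  refine ⟨95824 * 9, by norm_num, fun n => ?_⟩
  obtain ⟨order, horder⟩ := exists_sumset_order n
  suffices h : ∃ T : LinearDecisionTree (Fin n ⊕ Fin n) (sumsetVectors n → SignType),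
      (T.depth : ℝ) ≤ 95824 * 9 * n * Real.log n ^ 2 ∧
      (∀ q ∈ T.queries, ∃ g ∈ sumsetVectors n, ∃ h ∈ sumsetVectors n, q = g - h ∧
        ∀ c, q c = -1 ∨ q c = 0 ∨ q c = 1) ∧
      ∀ x, T.eval x = pointLocation (sumsetVectors n) x by
    obtain ⟨T, hd, hq, he⟩ := h
    refine ⟨T, fun q hqT => ?_, fun q hqT => ?_, hd, he, order, ?_⟩
    · obtain ⟨g, hg, h, hh, e, -⟩ := hq q hqT
      -- A label query also has this form, as a difference with `0`, itself a comparison vector.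
      exact Or.inr ⟨g, hg, h, hh, e⟩
    · obtain ⟨g, ⟨i, j, k, l, rfl⟩, h, ⟨i', j', k', l', rfl⟩, rfl, hc⟩ := hq q hqT
      exact ⟨isSparse_sub (card_support_sumComparison i j k l)
        (card_support_sumComparison i' j' k' l'), hc⟩
    · rintro _ _ - - a b rfl rfl
      rw [he]
      exact horder a b
  rcases Nat.lt_or_ge n 2 with hn | hn
  -- Here `log n = 0` forces depth `0`. A leaf suffices because every comparison vector is zero.
  · have hsub : Subsingleton (Fin n) := Fin.subsingleton_iff_le_one.2 (by omega)
    refine ⟨.leaf (pointLocation _ 0), ?_, by simp [LinearDecisionTree.queries], fun x => ?_⟩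
    · simp only [LinearDecisionTree.depth, Nat.cast_zero]
      positivity
    · funext ⟨h, i, j, k, l, hh⟩
      obtain rfl := Subsingleton.elim i k
      obtain rfl := Subsingleton.elim j l
      simp [LinearDecisionTree.eval, pointLocation, hh, sumComparison]
  · obtain ⟨T, hd, hT⟩ := exists_sumset_tree hn
    refine ⟨T, ?_, hT⟩
    have h1 := clog_two_le_three_mul_log hn
    calc (T.depth : ℝ) ≤ ((95824 * (n * Nat.clog 2 n ^ 2) : ℕ) : ℝ) := by exact_mod_cast hd
      _ = 95824 * (n * (Nat.clog 2 n : ℝ) ^ 2) := by push_cast; ring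
      _ ≤ 95824 * (n * (3 * Real.log n) ^ 2) := by gcongr
      _ = _ := by ring
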